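/- All graphs are finite, simple and undirected. A set $D$ of vertices of a graph $G$ is a \emph{dominating set} if every vertex of $G$ outside $D$ has a neighbour in $D$; a dominating set $D$ is \emph{certified} if every vertex of $D$ has either zero or at least two neighbours outside $D$. Let $\gamma_{\mathrm{cer}}(G)$ denote the minimum cardinality of a certified dominating set of $G$. Write $G+v$ for a graph obtained from $G$ by adding one new vertex $v$ and joining it to some set (possibly empty) of vertices of $G$; the new vertex $v$ is called a \emph{leaf} if its degree in $G+v$ is exactly one. \textbf{Theorem.} (a) Let $G$ be any graph, not necessarily connected. If a new vertex $v$ that is not a leaf of $G+v$ is added to $G$, then $$\gamma_{\mathrm{cer}}(G+v)\le \gamma_{\mathrm{cer}}(G)+1 .$$ (b) By contrast, adding a leaf can increase $\gamma_{\mathrm{cer}}$ by an arbitrarily large amount: for every integer $i\ge 1$ there are a graph $G$ on $2i+1$ vertices and a graph $G+v$, in which the new vertex $v$ is a leaf, such that $$\gamma_{\mathrm{cer}}(G)=i \quad\text{and}\quad \gamma_{\mathrm{cer}}(G+v)=2i+2 .$$ -/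

import Mathlib

namespace SimpleGraph

variable {V : Type*}

/-- Every vertex outside `D` has a neighbour in `D`. -/
def IsDominating (G : SimpleGraph V) (D : Set V) : Prop :=
  ∀ v, v ∉ D → ∃ w ∈ D, G.Adj v w

/-- A dominating set `D` is certified if every vertex of `D` has either zero or at least two
neighbours outside `D`. -/
def IsCertifiedDominating (G : SimpleGraph V) (D : Set V) : Prop :=
  G.IsDominating D ∧
    ∀ v ∈ D, (G.neighborSet v \ D).encard = 0 ∨ 2 ≤ (G.neighborSet v \ D).encard

/-- The minimum cardinality of a certified dominating set (of a finite graph). -/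
noncomputable def certifiedDominationNumber (G : SimpleGraph V) : ℕ :=
  sInf {n | ∃ D : Finset V, G.IsCertifiedDominating (D : Set V) ∧ D.card = n}

/-- The graph obtained from `G` by adding one new vertex `none`, joined exactly to the vertices
in `S`. -/
def addVertex (G : SimpleGraph V) (S : Set V) : SimpleGraph (Option V) where
  Adj
    | some a, some b => G.Adj a b
    | some a, none => a ∈ S
    | none, some b => b ∈ S
    | none, none => False
  symm := ⟨by
    rintro (_ | a) (_ | b) h
    · exact h
    · exact h
    · exact h
    · exact G.adj_symm h⟩
  loopless := ⟨by
    rintro (_ | a) h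
    · exact h
    · exact G.irrefl h⟩

theorem isCertifiedDominating_univ (G : SimpleGraph V) :
    G.IsCertifiedDominating Set.univ := by
  simp [IsCertifiedDominating, IsDominating]

/-- For a finite graph the certified domination number is an attained minimum. -/
theorem isLeast_certifiedDominationNumber [Finite V] (G : SimpleGraph V) :
    IsLeast {n | ∃ D : Finset V, G.IsCertifiedDominating (D : Set V) ∧ D.card = n}
      G.certifiedDominationNumber := by
  have := Fintype.ofFinite V
  refine ⟨Nat.sInf_mem ⟨_, Finset.univ, ?_, rfl⟩, fun n hn => Nat.sInf_le hn⟩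
  simpa using G.isCertifiedDominating_univ

end SimpleGraph

/-!
Call a vertex of a certified dominating set `D` *shadowed* if all its neighbours are in `D`. A set
`R` of shadowed vertices can be taken out of `D` if its vertices stay dominated and no remaining
shadowed vertex has exactly one neighbour in `R`. When `D` is minimal, there is no such `R ≠ ∅`,
and this forces the shadowed vertices that are not isolated to come in pairs, a support vertex
with its only leaf.

Let `S` be the neighbourhood of the new vertex `v`. The set `D ∪ {v}` is certified in `G + v`
unless `S` has exactly one vertex `w` outside `D`. In that case, if every shadowed vertex of `S` is
the support of a leaf outside `S`, then removing these leaves from `D` gives a certified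
dominating set, as such a support now has its leaf and `v` outside. Otherwise some `a ∈ S` lies in
a set `R` that can be removed from `D ∪ {v}`, where `v` dominates `R ∩ S` and now has the two
neighbours `a` and `w` outside.

For part (b), a certified dominating set contains every support vertex, and also the leaf of a
support vertex whose other neighbours are all supports. In a subdivided star, the supports are the
middle vertices. A leaf added at the centre makes every vertex a support or the only leaf of one.
-/

namespace CertifiedDomination

open SimpleGraph

variable {V : Type*} {G : SimpleGraph V} {A B D E R S T : Set V} {a b l s t x y z : V}

theorem encard_ne_one_iff {α : Type*} {s : Set α} :
    s.encard ≠ 1 ↔ (s.Nonempty → s.Nontrivial) := by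
  rw [Ne, Set.encard_eq_one]
  refine ⟨fun h ⟨x, hx⟩ => (Set.eq_singleton_or_nontrivial hx).resolve_left fun hs => h ⟨x, hs⟩, ?_⟩
  rintro h ⟨x, rfl⟩
  exact Set.not_nontrivial_singleton (h (Set.singleton_nonempty x))

theorem isCertifiedDominating_iff_encard_ne_one :
    G.IsCertifiedDominating D ↔
      G.IsDominating D ∧ ∀ z ∈ D, (G.neighborSet z \ D).encard ≠ 1 := by
  refine and_congr Iff.rfl (forall₂_congr fun z _ => ?_)
  rw [ne_iff_lt_or_gt, Order.lt_one_iff, ← Order.add_one_le_iff_of_not_isMax (by simp),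
    one_add_one_eq_two]

/-- `x` is a leaf (a vertex of degree one) and `y` is its neighbour, a *support* vertex. -/
def IsLeafAt (G : SimpleGraph V) (x y : V) : Prop :=
  G.neighborSet x = {y}

theorem IsLeafAt.adj_iff (h : IsLeafAt G x y) : G.Adj x z ↔ z = y := by
  rw [← mem_neighborSet, h, Set.mem_singleton_iff]

theorem IsLeafAt.adj (h : IsLeafAt G x y) : G.Adj x y :=
  h.adj_iff.2 rfl

theorem IsLeafAt.eq_of_adj (h : IsLeafAt G x y) (hz : G.Adj z x) : z = y :=
  h.adj_iff.1 hz.symm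

theorem IsLeafAt.not_nontrivial (h : IsLeafAt G x y) : ¬ (G.neighborSet x).Nontrivial :=
  h ▸ Set.not_nontrivial_singleton

theorem isLeafAt_or_nontrivial (h : G.Adj x y) :
    IsLeafAt G x y ∨ (G.neighborSet x).Nontrivial :=
  Set.eq_singleton_or_nontrivial h

/-- The vertices of `D` without neighbours outside `D`. -/
def shadowed (G : SimpleGraph V) (D : Set V) : Set V :=
  {z ∈ D | G.neighborSet z ⊆ D}

theorem IsLeafAt.mem_shadowed (h : IsLeafAt G x y) (hx : x ∈ D) (hy : y ∈ D) :
    x ∈ shadowed G D :=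
  ⟨hx, h.subset.trans (Set.singleton_subset_iff.2 hy)⟩

theorem IsLeafAt.mem_shadowed_of_support (h : IsLeafAt G x y) (hy : y ∈ shadowed G D) :
    x ∈ shadowed G D :=
  h.mem_shadowed (hy.2 h.adj.symm) hy.1

/-! ### Removing shadowed vertices -/

/-- Removing the set `R` of shadowed vertices from `D` leaves a certified dominating set, except
that vertices of `R ∩ A` need not be dominated any more: the set `A` stands for the vertices that
will be dominated by a new vertex. -/
structure IsRemovable (G : SimpleGraph V) (D A R : Set V) : Prop where
  subset_shadowed : R ⊆ shadowed G D
  dominated : ∀ r ∈ R, r ∈ A ∨ ∃ y ∉ R, G.Adj r y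
  certified : ∀ z ∈ shadowed G D \ R, (G.neighborSet z ∩ R).encard ≠ 1

theorem isRemovable_empty : IsRemovable G D A ∅ := by
  constructor <;> simp

theorem exists_adj_diff_of_subset_shadowed (hD : G.IsDominating D) (hR : R ⊆ shadowed G D)
    (hx : x ∉ D) : ∃ y ∈ D \ R, G.Adj x y := by
  obtain ⟨y, hy, hxy⟩ := hD x hx
  exact ⟨y, ⟨hy, fun hyR => hx ((hR hyR).2 hxy.symm)⟩, hxy⟩

theorem encard_neighborSet_diff_diff_ne_one (hD : G.IsCertifiedDominating D) (hz : z ∈ D)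
    (h : z ∈ shadowed G D → (G.neighborSet z ∩ R).encard ≠ 1) :
    (G.neighborSet z \ (D \ R)).encard ≠ 1 := by
  by_cases hzD : G.neighborSet z ⊆ D
  · rw [Set.sdiff_sdiff_right, Set.sdiff_eq_empty.2 hzD, Set.empty_union]
    exact h ⟨hz, hzD⟩
  · have hout : (G.neighborSet z \ D).Nontrivial :=
      encard_ne_one_iff.1 ((isCertifiedDominating_iff_encard_ne_one.1 hD).2 z hz)
        (Set.sdiff_nonempty.2 hzD)
    exact encard_ne_one_iff.2 fun _ => hout.mono (Set.sdiff_subset_sdiff_right Set.sdiff_subset)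

namespace IsRemovable

theorem mem_or_exists_adj (hR : IsRemovable G D A R) (hD : G.IsDominating D) (hx : x ∉ D \ R) :
    x ∈ A ∨ ∃ y ∈ D \ R, G.Adj x y := by
  by_cases hxR : x ∈ R
  · exact (hR.dominated x hxR).imp_right fun ⟨y, hy, hxy⟩ =>
      ⟨y, ⟨(hR.subset_shadowed hxR).2 hxy, hy⟩, hxy⟩
  · exact Or.inr (exists_adj_diff_of_subset_shadowed hD hR.subset_shadowed fun h => hx ⟨h, hxR⟩)

theorem encard_neighborSet_diff_ne_one (hR : IsRemovable G D A R) (hD : G.IsCertifiedDominating D)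
    (hz : z ∈ D \ R) : (G.neighborSet z \ (D \ R)).encard ≠ 1 :=
  encard_neighborSet_diff_diff_ne_one hD hz.1 fun h => hR.certified z ⟨h, hz.2⟩

theorem isCertifiedDominating_diff (hR : IsRemovable G D ∅ R) (hD : G.IsCertifiedDominating D) :
    G.IsCertifiedDominating (D \ R) :=
  isCertifiedDominating_iff_encard_ne_one.2
    ⟨fun _ hx => (hR.mem_or_exists_adj hD.1 hx).resolve_left (Set.notMem_empty _),
      fun _ hz => hR.encard_neighborSet_diff_ne_one hD hz⟩

theorem eq_empty (hR : IsRemovable G D ∅ R) (hD : Minimal G.IsCertifiedDominating D) : R = ∅ := by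
  have hDR : D ⊆ D \ R := hD.2 (hR.isCertifiedDominating_diff hD.1) Set.sdiff_subset
  exact Set.eq_empty_of_forall_notMem fun r hr => (hDR (hR.subset_shadowed hr).1).2 hr

end IsRemovable

/-- `B` together with the leaves of all shadowed neighbours of `B`. Adding these leaves gives
every shadowed support with a neighbour in `B` a second one, namely its leaf. -/
def addLeaves (G : SimpleGraph V) (D B : Set V) : Set V :=
  B ∪ {x | ∃ p ∈ shadowed G D, IsLeafAt G x p ∧ (G.neighborSet p ∩ B).Nonempty}

theorem subset_addLeaves : B ⊆ addLeaves G D B :=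
  Set.subset_union_left

theorem isRemovable_addLeaves (hB : B ⊆ shadowed G D)
    (hleaf : ∀ p ∈ B, ∀ x, IsLeafAt G x p → x ∈ B)
    (hdom : ∀ r ∈ B, r ∈ A ∨ ∃ y ∉ B, G.Adj r y)
    (hcert : ∀ z ∈ shadowed G D \ B, (G.neighborSet z ∩ B).encard = 1 → ∃ x ∉ B, IsLeafAt G x z) :
    IsRemovable G D A (addLeaves G D B) := by
  refine ⟨?_, fun r hr => ?_, ?_⟩
  · rintro r (hr | ⟨p, hp, hrp, -⟩)
    exacts [hB hr, hrp.mem_shadowed_of_support hp]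
  · by_cases hrB : r ∈ B
    · refine (hdom r hrB).imp_right fun ⟨y, hyB, hry⟩ => ⟨y, ?_, hry⟩
      rintro (hy | ⟨p, -, hyp, -⟩)
      exacts [hyB hy, hyB (hleaf r hrB y (hyp.eq_of_adj hry ▸ hyp))]
    · obtain ⟨p, -, hrp, u, hpu, hu⟩ := hr.resolve_left hrB
      refine Or.inr ⟨p, ?_, hrp.adj⟩
      rintro (hpB | ⟨q, -, hpq, -⟩)
      · exact hrB (hleaf p hpB r hrp)
      · obtain rfl : r = u := (hpq.eq_of_adj hrp.adj).trans (hpq.adj_iff.1 hpu).symm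
        exact hrB hu
  · rintro z ⟨hz, hzR⟩
    rw [encard_ne_one_iff]
    rintro ⟨r, hzr, hr⟩
    by_cases hrB : r ∈ B
    · by_cases hone : (G.neighborSet z ∩ B).encard = 1
      · obtain ⟨x, hxB, hxz⟩ := hcert z ⟨hz, fun h => hzR (subset_addLeaves h)⟩ hone
        exact ⟨r, ⟨hzr, hr⟩, x, ⟨hxz.adj.symm, Or.inr ⟨z, hz, hxz, r, hzr, hrB⟩⟩,
          fun h => hxB (h ▸ hrB)⟩
      · exact (encard_ne_one_iff.1 hone ⟨r, hzr, hrB⟩).mono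
          (Set.inter_subset_inter_right _ subset_addLeaves)
    · obtain ⟨p, -, hrp, u, hpu, hu⟩ := hr.resolve_left hrB
      obtain rfl : z = p := hrp.eq_of_adj hzr
      exact ⟨r, ⟨hzr, hr⟩, u, ⟨hpu, subset_addLeaves hu⟩, fun h => hrB (h ▸ hu)⟩

/-! ### Shadowed vertices of a minimal certified dominating set -/

theorem isRemovable_leaves (hy : y ∈ D)
    (h : y ∈ shadowed G D → {x ∈ D | IsLeafAt G x y}.encard ≠ 1) :
    IsRemovable G D ∅ {x ∈ D | IsLeafAt G x y} := by
  refine ⟨fun x hx => hx.2.mem_shadowed hx.1 hy,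
    fun x hx => Or.inr ⟨y, fun h' => h'.2.adj.ne rfl, hx.2.adj⟩, fun z hz => ?_⟩
  by_cases hzy : z = y
  · subst hzy
    rw [Set.inter_eq_right.2 fun x hx => hx.2.adj.symm]
    exact h hz.1
  · exact encard_ne_one_iff.2 fun ⟨x, hzx, hx⟩ => absurd (hx.2.eq_of_adj hzx) hzy

theorem IsLeafAt.support_mem_shadowed (h : IsLeafAt G x y)
    (hD : Minimal G.IsCertifiedDominating D) (hx : x ∈ shadowed G D) : y ∈ shadowed G D := by
  by_contra hy
  have hempty := (isRemovable_leaves (hx.2 h.adj) fun h' => absurd h' hy).eq_empty hD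
  exact hempty.subset ⟨hx.1, h⟩

theorem IsLeafAt.eq_of_support_mem_shadowed (hx : IsLeafAt G x y) (hz : IsLeafAt G z y)
    (hD : Minimal G.IsCertifiedDominating D) (hy : y ∈ shadowed G D) : x = z := by
  by_contra hne
  have hxL : x ∈ {x ∈ D | IsLeafAt G x y} := ⟨hy.2 hx.adj.symm, hx⟩
  have hzL : z ∈ {x ∈ D | IsLeafAt G x y} := ⟨hy.2 hz.adj.symm, hz⟩
  have hempty := (isRemovable_leaves hy.1 fun _ =>
    encard_ne_one_iff.2 fun _ => ⟨x, hxL, z, hzL, hne⟩).eq_empty hD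
  exact hempty.subset hxL

/-- The vertices outside `B` with a neighbour outside `B`, that is, the support of the graph induced
on the complement of `B`. The set `B` of `exists_subset_forall_nontrivial_inter` minimizes it. -/
def outerVertices (G : SimpleGraph V) (B : Set V) : Set V :=
  {x | x ∉ B ∧ ∃ y ∉ B, G.Adj x y}

theorem outerVertices_anti (h : A ⊆ B) : outerVertices G B ⊆ outerVertices G A :=
  fun _ ⟨hx, y, hy, hxy⟩ => ⟨fun hxA => hx (h hxA), y, fun hyA => hy (h hyA), hxy⟩

theorem outerVertices_exchange_subset (hs : ∀ z ∉ B, G.Adj s z → z = t) :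
    outerVertices G (insert t (B \ {s})) ⊆ outerVertices G B := by
  have hs' : ∀ z ∉ insert t (B \ {s}), ¬ G.Adj s z := fun z hz hsz =>
    hz (Or.inl (hs z (fun hzB => hz (Or.inr ⟨hzB, hsz.ne'⟩)) hsz))
  have hmem : ∀ x ∉ insert t (B \ {s}), x ≠ s → x ∉ B := fun x hx hxs hxB =>
    hx (Or.inr ⟨hxB, hxs⟩)
  rintro x ⟨hx, z, hz, hxz⟩
  exact ⟨hmem x hx fun h => hs' z hz (h ▸ hxz), z,
    hmem z hz fun h => hs' x hx (h ▸ hxz.symm), hxz⟩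

theorem exists_adj_notMem_exchange (hB : ∀ r ∈ B, ∃ y ∉ B, G.Adj r y) (hst : G.Adj s t)
    (hunique : ∀ r ∈ B, G.Adj r t → r = s) :
    ∀ r ∈ insert t (B \ {s}), ∃ y ∉ insert t (B \ {s}), G.Adj r y := by
  rintro r (rfl | ⟨hr, hrs⟩)
  · exact ⟨s, by simp [hst.ne], hst.symm⟩
  · obtain ⟨z, hzB, hrz⟩ := hB r hr
    have hzt : z ≠ t := fun h => hrs (hunique r hr (h ▸ hrz))
    exact ⟨z, by simp [hzt, hzB], hrz⟩

theorem exists_subset_forall_nontrivial_inter (G : SimpleGraph V) (hT : T.Finite) :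
    ∃ B ⊆ T, (∀ r ∈ B, ∃ y ∉ B, G.Adj r y) ∧
      ∀ t ∈ T \ B, (G.neighborSet t).Nontrivial → (G.neighborSet t ∩ B).Nontrivial := by
  obtain ⟨B, ⟨hBT, hB⟩, hmin⟩ :=
    (hT.finite_subsets.subset fun B hB => hB.1).exists_minimalFor (outerVertices G)
      {B | B ⊆ T ∧ ∀ r ∈ B, ∃ y ∉ B, G.Adj r y} ⟨∅, by simp⟩
  refine ⟨B, hBT, hB, fun t ⟨htT, htB⟩ htn => ?_⟩
  by_contra hcon
  obtain ⟨y, hty, hyB⟩ : ∃ y, G.Adj t y ∧ y ∉ B := by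
    by_contra! h
    exact hcon (htn.mono fun y hy => ⟨hy, h y hy⟩)
  have no_improvement : ∀ B' ⊆ T, (∀ r ∈ B', ∃ y ∉ B', G.Adj r y) → t ∈ B' →
      ¬ outerVertices G B' ⊆ outerVertices G B := fun B' hB'T hB' ht hsub =>
    (hmin ⟨hB'T, hB'⟩ hsub ⟨htB, y, hyB, hty⟩).1 ht
  -- As `B ∪ {t}` is no improvement, `t` is the only neighbour outside `B` of some `s ∈ B`.
  obtain ⟨s, hsB, hs⟩ : ∃ s ∈ B, ∀ z ∉ B, G.Adj s z → z = t := by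
    by_contra! h
    refine no_improvement (insert t B) (Set.insert_subset htT hBT) ?_ (Set.mem_insert _ _)
      (outerVertices_anti (Set.subset_insert _ _))
    rintro r (rfl | hr)
    · exact ⟨y, by simp [hyB, hty.ne'], hty⟩
    · obtain ⟨z, hzB, hrz, hzt⟩ := h r hr
      exact ⟨z, by simp [hzB, hzt], hrz⟩
  have hst : G.Adj s t := by
    obtain ⟨z, hzB, hsz⟩ := hB s hsB
    exact hs z hzB hsz ▸ hsz
  have hunique : ∀ r ∈ B, G.Adj r t → r = s := fun r hr hrt => by
    by_contra hrs
    exact hcon ⟨r, ⟨hrt.symm, hr⟩, s, ⟨hst.symm, hsB⟩, hrs⟩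
  -- Exchanging `s` for `t` takes `t` out of the outer vertices and does not put `s` into them.
  exact no_improvement (insert t (B \ {s}))
    (Set.insert_subset htT (Set.sdiff_subset.trans hBT))
    (exists_adj_notMem_exchange hB hst hunique) (Set.mem_insert _ _)
    (outerVertices_exchange_subset hs)

theorem exists_isLeafAt_of_mem_shadowed (hD : Minimal G.IsCertifiedDominating D) (hfin : D.Finite)
    (hz : z ∈ shadowed G D) (hzn : (G.neighborSet z).Nontrivial) : ∃ x, IsLeafAt G x z := by
  by_contra! hzl
  let T : Set V := {t ∈ shadowed G D | (G.neighborSet t).Nontrivial ∧ ∀ x, ¬ IsLeafAt G x t}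
  obtain ⟨B, hBT, hout, htwo⟩ :=
    exists_subset_forall_nontrivial_inter G (hfin.subset fun t (ht : t ∈ T) => ht.1.1)
  have hR : IsRemovable G D ∅ (addLeaves G D B) := by
    refine isRemovable_addLeaves (fun _ hr => (hBT hr).1)
      (fun p hp x hx => absurd hx ((hBT hp).2.2 x)) (fun r hr => Or.inr (hout r hr)) ?_
    rintro u ⟨hu, huB⟩ hone
    obtain ⟨r, hr⟩ := Set.encard_eq_one.1 hone
    obtain ⟨hur, hrB⟩ : r ∈ G.neighborSet u ∩ B := hr ▸ rfl
    have hun : (G.neighborSet u).Nontrivial :=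
      (isLeafAt_or_nontrivial hur).resolve_left ((hBT hrB).2.2 u)
    have huT : u ∉ T := fun huT => by
      have := htwo u ⟨huT, huB⟩ hun
      exact Set.not_nontrivial_singleton (hr ▸ this)
    obtain ⟨x, hx⟩ : ∃ x, IsLeafAt G x u := by
      by_contra! h
      exact huT ⟨hu, hun, h⟩
    exact ⟨x, fun hxB => hx.not_nontrivial (hBT hxB).2.1, hx⟩
  have hempty : B = ∅ := Set.subset_eq_empty subset_addLeaves (hR.eq_empty hD)
  simpa [hempty] using htwo z ⟨⟨hz, hzn, hzl⟩, by simp [hempty]⟩ hzn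

theorem IsLeafAt.isRemovable_addLeaves_pair (h : IsLeafAt G a b)
    (hD : Minimal G.IsCertifiedDominating D) (hfin : D.Finite) (ha : a ∈ shadowed G D)
    (haA : a ∈ A) (hb : b ∈ A ∨ (G.neighborSet b).Nontrivial) :
    IsRemovable G D A (addLeaves G D {a, b}) := by
  have hbs : b ∈ shadowed G D := h.support_mem_shadowed hD ha
  refine isRemovable_addLeaves (Set.pair_subset ha hbs) ?_ ?_ ?_
  · rintro p (rfl | rfl) x hx
    · exact Or.inr (h.adj_iff.1 hx.adj.symm)
    · exact Or.inl (hx.eq_of_support_mem_shadowed h hD hbs)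
  · rintro r (rfl | rfl)
    · exact Or.inl haA
    · refine hb.imp_right fun hn => ?_
      obtain ⟨c, hc, hca⟩ := hn.exists_ne a
      exact ⟨c, by simp [hca, hc.ne'], hc⟩
  · rintro z ⟨hz, hzB⟩ hone
    have hza : z ≠ a := fun h => hzB (Or.inl h)
    have hzb : z ≠ b := fun h => hzB (Or.inr h)
    have hadj : G.Adj z b := by
      obtain ⟨r, hzr, rfl | rfl⟩ := Set.encard_ne_zero.1 (hone ▸ one_ne_zero)
      exacts [absurd (h.eq_of_adj hzr) hzb, hzr]
    have hzn : (G.neighborSet z).Nontrivial := (isLeafAt_or_nontrivial hadj).resolve_left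
      fun h' => hza (h'.eq_of_support_mem_shadowed h hD hbs)
    obtain ⟨x, hx⟩ := exists_isLeafAt_of_mem_shadowed hD hfin hz hzn
    refine ⟨x, ?_, hx⟩
    rintro (rfl | rfl)
    exacts [hzb (h.adj_iff.1 hx.adj), hza (hx.eq_of_adj h.adj).symm]

theorem exists_isRemovable_mem (hD : Minimal G.IsCertifiedDominating D) (hfin : D.Finite)
    (ha : a ∈ shadowed G D) (haA : a ∈ A) (hleaf : ∀ x, IsLeafAt G x a → x ∈ A) :
    ∃ R, a ∈ R ∧ IsRemovable G D A R := by
  rcases (G.neighborSet a).eq_empty_or_nonempty with hiso | ⟨b, hab⟩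
  · have hadj : ∀ z, ¬ G.Adj a z := Set.eq_empty_iff_forall_notMem.1 hiso
    refine ⟨{a}, rfl, by simpa using ha, by simp [haA], fun z _ => ?_⟩
    exact encard_ne_one_iff.2 fun ⟨_, hzr, hr⟩ => absurd (hr ▸ hzr : G.Adj z a).symm (hadj z)
  rcases isLeafAt_or_nontrivial hab with hl | hn
  · have hb : b ∈ A ∨ (G.neighborSet b).Nontrivial :=
      (isLeafAt_or_nontrivial hab.symm).imp_left (hleaf b)
    exact ⟨_, subset_addLeaves (by simp), hl.isRemovable_addLeaves_pair hD hfin ha haA hb⟩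
  · obtain ⟨x, hx⟩ := exists_isLeafAt_of_mem_shadowed hD hfin ha hn
    exact ⟨_, subset_addLeaves (by simp), hx.isRemovable_addLeaves_pair hD hfin
      (hx.mem_shadowed_of_support ha) (hleaf x hx) (Or.inl haA)⟩

/-! ### Certified dominating sets after adding a vertex -/

theorem neighborSet_addVertex_none : (G.addVertex S).neighborSet none = some '' S := by
  ext (_ | x) <;> simp [addVertex]

theorem encard_neighborSet_addVertex_none :
    ((G.addVertex S).neighborSet none).encard = S.encard := by
  rw [neighborSet_addVertex_none, (Option.some_injective V).encard_image]

theorem isCertifiedDominating_addVertex_insert_none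
    (hdom : ∀ x ∉ E, x ∈ S ∨ ∃ y ∈ E, G.Adj x y) (hS : (S \ E).encard ≠ 1)
    (hcert : ∀ z ∈ E, (G.neighborSet z \ E).encard ≠ 1) :
    (G.addVertex S).IsCertifiedDominating (insert none (some '' E)) := by
  refine isCertifiedDominating_iff_encard_ne_one.2 ⟨?_, ?_⟩
  · rintro (_ | x) hx
    · simp at hx
    · rcases hdom x (by simpa using hx) with h | ⟨y, hy, hxy⟩
      exacts [⟨none, by simp, h⟩, ⟨some y, by simpa using hy, hxy⟩]
  · rintro (_ | z) hz
    · have hnbr : (G.addVertex S).neighborSet none \ insert none (some '' E) = some '' (S \ E) := by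
        ext (_ | x) <;> simp [addVertex]
      rwa [hnbr, (Option.some_injective V).encard_image]
    · have hnbr : (G.addVertex S).neighborSet (some z) \ insert none (some '' E) =
          some '' (G.neighborSet z \ E) := by
        ext (_ | x) <;> simp [addVertex]
      rw [hnbr, (Option.some_injective V).encard_image]
      exact hcert z (by simpa using hz)

theorem isCertifiedDominating_addVertex_image_some (hdom : G.IsDominating E)
    (hS : (S ∩ E).Nonempty) (hcertS : ∀ z ∈ E ∩ S, (G.neighborSet z \ E).Nonempty)
    (hcert : ∀ z ∈ E \ S, (G.neighborSet z \ E).encard ≠ 1) :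
    (G.addVertex S).IsCertifiedDominating (some '' E) := by
  refine isCertifiedDominating_iff_encard_ne_one.2 ⟨?_, ?_⟩
  · rintro (_ | x) hx
    · obtain ⟨a, haS, haE⟩ := hS
      exact ⟨some a, ⟨a, haE, rfl⟩, haS⟩
    · obtain ⟨y, hy, hxy⟩ := hdom x (by simpa using hx)
      exact ⟨some y, ⟨y, hy, rfl⟩, hxy⟩
  · rintro _ ⟨z, hz, rfl⟩
    by_cases hzS : z ∈ S
    · obtain ⟨x, hzx, hx⟩ := hcertS z ⟨hz, hzS⟩
      exact encard_ne_one_iff.2 fun _ =>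
        ⟨none, ⟨hzS, by simp⟩, some x, ⟨hzx, by simpa using hx⟩, by simp⟩
    · have hnbr : (G.addVertex S).neighborSet (some z) \ some '' E =
          some '' (G.neighborSet z \ E) := by
        ext (_ | x) <;> simp [addVertex, hzS]
      rw [hnbr, (Option.some_injective V).encard_image]
      exact hcert z ⟨hz, hzS⟩

theorem IsRemovable.isCertifiedDominating_addVertex (hR : IsRemovable G D S R)
    (hD : G.IsCertifiedDominating D) (hS : (S \ (D \ R)).encard ≠ 1) :
    (G.addVertex S).IsCertifiedDominating (insert none (some '' (D \ R))) :=
  isCertifiedDominating_addVertex_insert_none (fun _ hx => hR.mem_or_exists_adj hD.1 hx) hS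
    fun _ hz => hR.encard_neighborSet_diff_ne_one hD hz

theorem exists_isCertifiedDominating_addVertex_image_some (hD : G.IsCertifiedDominating D)
    (hSD : (S ∩ D).Nonempty) (hleaf : ∀ a ∈ S ∩ shadowed G D, ∃ x ∉ S, IsLeafAt G x a) :
    ∃ E ⊆ D, (G.addVertex S).IsCertifiedDominating (some '' E) := by
  let L : Set V := {x | x ∉ S ∧ ∃ a ∈ S ∩ shadowed G D, IsLeafAt G x a}
  have hL : L ⊆ shadowed G D := fun x ⟨_, a, ha, hxa⟩ => hxa.mem_shadowed_of_support ha.2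
  have hSL : ∀ a ∈ S, a ∉ L := fun a ha haL => haL.1 ha
  refine ⟨D \ L, Set.sdiff_subset, isCertifiedDominating_addVertex_image_some ?_ ?_ ?_ ?_⟩
  · intro x hx
    by_cases hxL : x ∈ L
    · obtain ⟨-, a, ⟨haS, has⟩, hxa⟩ := hxL
      exact ⟨a, ⟨has.1, hSL a haS⟩, hxa.adj⟩
    · exact exists_adj_diff_of_subset_shadowed hD.1 hL fun h => hx ⟨h, hxL⟩
  · exact hSD.mono fun a ha => ⟨ha.1, ha.2, hSL a ha.1⟩
  · rintro z ⟨⟨hzD, -⟩, hzS⟩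
    by_cases hz : G.neighborSet z ⊆ D
    · obtain ⟨x, hxS, hxz⟩ := hleaf z ⟨hzS, hzD, hz⟩
      exact ⟨x, hxz.adj.symm, fun hx => hx.2 ⟨hxS, z, ⟨hzS, hzD, hz⟩, hxz⟩⟩
    · exact (Set.sdiff_nonempty.2 hz).mono (Set.sdiff_subset_sdiff_right Set.sdiff_subset)
  · rintro z ⟨⟨hzD, -⟩, hzS⟩
    refine encard_neighborSet_diff_diff_ne_one hD hzD fun _ => encard_ne_one_iff.2 ?_
    rintro ⟨x, hzx, -, a, ⟨haS, -⟩, hxa⟩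
    exact absurd (hxa.eq_of_adj hzx ▸ haS) hzS

theorem exists_isCertifiedDominating_addVertex_subset (hD : Minimal G.IsCertifiedDominating D)
    (hfin : D.Finite) (hS : S.encard ≠ 1) :
    ∃ E ⊆ insert none (some '' D), (G.addVertex S).IsCertifiedDominating E := by
  by_cases hSD : (S \ D).encard = 1
  swap
  · exact ⟨_, Set.insert_subset_insert (Set.image_mono Set.sdiff_subset),
      isRemovable_empty.isCertifiedDominating_addVertex hD.1 (by simpa using hSD)⟩
  by_cases hleaf : ∀ a ∈ S ∩ shadowed G D, ∃ x ∉ S, IsLeafAt G x a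
  · have hne : (S ∩ D).Nonempty := by
      by_contra h
      rw [Set.not_nonempty_iff_eq_empty, ← Set.disjoint_iff_inter_eq_empty] at h
      exact hS (h.sdiff_eq_left ▸ hSD)
    obtain ⟨E, hED, hE⟩ := exists_isCertifiedDominating_addVertex_image_some hD.1 hne hleaf
    exact ⟨_, (Set.image_mono hED).trans (Set.subset_insert _ _), hE⟩
  · push Not at hleaf
    obtain ⟨a, ⟨haS, ha⟩, hal⟩ := hleaf
    obtain ⟨R, haR, hR⟩ := exists_isRemovable_mem hD hfin ha haS fun x hx =>
      by_contra fun hxS => hal x hxS hx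
    obtain ⟨w, hwS, hwD⟩ : (S \ D).Nonempty := Set.encard_ne_zero.1 (hSD ▸ one_ne_zero)
    have htwo : (S \ (D \ R)).Nontrivial :=
      ⟨a, ⟨haS, fun h => h.2 haR⟩, w, ⟨hwS, fun h => hwD h.1⟩, fun h => hwD (h ▸ ha.1)⟩
    exact ⟨_, Set.insert_subset_insert (Set.image_mono Set.sdiff_subset),
      hR.isCertifiedDominating_addVertex hD.1 (encard_ne_one_iff.2 fun _ => htwo)⟩

theorem certifiedDominationNumber_le_ncard (hfin : D.Finite) (hD : G.IsCertifiedDominating D) :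
    G.certifiedDominationNumber ≤ D.ncard :=
  Nat.sInf_le ⟨hfin.toFinset, by simpa using hD, (Set.ncard_eq_toFinset_card D hfin).symm⟩

theorem exists_minimal_isCertifiedDominating
    (h : ∃ D : Finset V, G.IsCertifiedDominating (D : Set V)) :
    ∃ D : Finset V, Minimal G.IsCertifiedDominating (D : Set V) ∧
      D.card = G.certifiedDominationNumber := by
  obtain ⟨D, hD, hcard⟩ : G.certifiedDominationNumber ∈
      {n | ∃ D : Finset V, G.IsCertifiedDominating (D : Set V) ∧ D.card = n} :=
    Nat.sInf_mem (h.elim fun D hD => ⟨_, D, hD, rfl⟩)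
  refine ⟨D, ⟨hD, fun E hE hED => ?_⟩, hcard⟩
  have hle := certifiedDominationNumber_le_ncard (D.finite_toSet.subset hED) hE
  rw [← hcard, ← Set.ncard_coe_finset] at hle
  exact (Set.eq_of_subset_of_ncard_le hED hle).ge

theorem certifiedDominationNumber_addVertex_le
    (hG : ∃ D : Finset V, G.IsCertifiedDominating (D : Set V)) (hS : S.encard ≠ 1) :
    (G.addVertex S).certifiedDominationNumber ≤ G.certifiedDominationNumber + 1 := by
  obtain ⟨D, hD, hcard⟩ := exists_minimal_isCertifiedDominating hG
  obtain ⟨E, hED, hE⟩ := exists_isCertifiedDominating_addVertex_subset hD D.finite_toSet hS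
  have hfin : (insert none (some '' (D : Set V))).Finite := (D.finite_toSet.image _).insert _
  calc (G.addVertex S).certifiedDominationNumber ≤ E.ncard :=
        certifiedDominationNumber_le_ncard (hfin.subset hED) hE
    _ ≤ (insert none (some '' (D : Set V))).ncard := Set.ncard_le_ncard hED hfin
    _ ≤ (some '' (D : Set V)).ncard + 1 := Set.ncard_insert_le _ _
    _ = G.certifiedDominationNumber + 1 := by
        rw [Set.ncard_image_of_injective _ (Option.some_injective V), Set.ncard_coe_finset, hcard]

/-! ### Subdivided stars -/

theorem certifiedDominationNumber_eq_card {D : Finset V} (hD : G.IsCertifiedDominating (D : Set V))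
    (h : ∀ E, G.IsCertifiedDominating E → (D : Set V) ⊆ E) :
    G.certifiedDominationNumber = D.card := by
  obtain ⟨E, hE, hcard⟩ := exists_minimal_isCertifiedDominating ⟨D, hD⟩
  rw [← hcard, Finset.coe_injective (hE.eq_of_subset hD (h E hE.1))]

theorem IsLeafAt.support_mem (h : IsLeafAt G l s) (hD : G.IsCertifiedDominating D) : s ∈ D := by
  by_contra hs
  by_cases hl : l ∈ D
  · refine (isCertifiedDominating_iff_encard_ne_one.1 hD).2 l hl (Set.encard_eq_one.2 ⟨s, ?_⟩)
    rw [h, (Set.disjoint_singleton_left.2 hs).sdiff_eq_left]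
  · obtain ⟨w, hw, hlw⟩ := hD.1 l hl
    exact hs (h.adj_iff.1 hlw ▸ hw)

theorem IsLeafAt.mem (h : IsLeafAt G l s) (hD : G.IsCertifiedDominating D)
    (hs : ∀ y, G.Adj s y → y ≠ l → ∃ x, IsLeafAt G x y) : l ∈ D := by
  by_contra hl
  have hout : G.neighborSet s \ D = {l} := by
    refine Set.eq_singleton_iff_unique_mem.2 ⟨⟨h.adj.symm, hl⟩, fun y ⟨hsy, hy⟩ => ?_⟩
    by_contra hyl
    obtain ⟨x, hx⟩ := hs y hsy hyl
    exact hy (hx.support_mem hD)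
  exact (isCertifiedDominating_iff_encard_ne_one.1 hD).2 s (h.support_mem hD)
    (Set.encard_eq_one.2 ⟨l, hout⟩)

theorem IsLeafAt.addVertex (h : IsLeafAt G x y) (hx : x ∉ S) :
    IsLeafAt (G.addVertex S) (some x) (some y) := by
  ext (_ | z)
  · simp [SimpleGraph.addVertex, hx]
  · simpa [SimpleGraph.addVertex] using h.adj_iff

theorem isLeafAt_addVertex_singleton (G : SimpleGraph V) (y : V) :
    IsLeafAt (G.addVertex {y}) none (some y) := by
  rw [IsLeafAt, neighborSet_addVertex_none, Set.image_singleton]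

/-- The star with `i` rays, each subdivided once. The centre is `0`, the middle vertices are
`1, …, i`, and the end vertex next to `j` is `j + i`. The neighbour of a vertex `a` towards the
centre is `a - i`, where the truncation of the subtraction sends the middle vertices to `0`. -/
def subdividedStar (i : ℕ) : SimpleGraph (Fin (2 * i + 1)) :=
  SimpleGraph.fromRel fun a b => b.val = a.val - i

section subdividedStar

variable {i : ℕ} {j k : Fin (2 * i + 1)}

theorem subdividedStar_adj : (subdividedStar i).Adj j k ↔
    j.val ≠ k.val ∧ (k.val = j.val - i ∨ j.val = k.val - i) := by
  rw [subdividedStar, SimpleGraph.fromRel_adj, Ne, Fin.ext_iff]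

theorem isLeafAt_subdividedStar (hj : 1 ≤ j.val) (hk : k.val = j.val + i) :
    IsLeafAt (subdividedStar i) k j := by
  ext t
  rw [mem_neighborSet, subdividedStar_adj, Set.mem_singleton_iff, Fin.ext_iff]
  omega

theorem isCertifiedDominating_middle_subdividedStar (hi : 1 ≤ i) :
    (subdividedStar i).IsCertifiedDominating {j | 1 ≤ j.val ∧ j.val ≤ i} := by
  refine isCertifiedDominating_iff_encard_ne_one.2 ⟨fun k hk => ?_, fun j ⟨hj, hji⟩ => ?_⟩
  · rw [Set.mem_ofPred_eq] at hk
    by_cases hk0 : k.val = 0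
    · exact ⟨⟨1, by omega⟩, ⟨le_rfl, hi⟩, subdividedStar_adj.2 (by simp only; omega)⟩
    · exact ⟨⟨k.val - i, by omega⟩, ⟨by simp only; omega, by simp only; omega⟩,
        subdividedStar_adj.2 ⟨by simp only; omega, Or.inl rfl⟩⟩
  · have hcentre : 0 ∈ (subdividedStar i).neighborSet j \ {j | 1 ≤ j.val ∧ j.val ≤ i} :=
      ⟨subdividedStar_adj.2 (by simp only [Fin.val_zero]; omega), by simp⟩
    have hend : ⟨j.val + i, by omega⟩ ∈
        (subdividedStar i).neighborSet j \ {j | 1 ≤ j.val ∧ j.val ≤ i} :=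
      ⟨subdividedStar_adj.2 (by simp only; omega), fun ⟨_, h⟩ => by simp only at h; omega⟩
    refine encard_ne_one_iff.2 fun _ => ⟨_, hcentre, _, hend, fun h => ?_⟩
    have := congrArg Fin.val h
    simp only [Fin.val_zero] at this
    omega

theorem certifiedDominationNumber_subdividedStar (hi : 1 ≤ i) :
    (subdividedStar i).certifiedDominationNumber = i := by
  let M : Finset (Fin (2 * i + 1)) := Finset.Icc ⟨1, by omega⟩ ⟨i, by omega⟩
  have hM : (M : Set (Fin (2 * i + 1))) = {j | 1 ≤ j.val ∧ j.val ≤ i} := by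
    ext j
    simp [M, Fin.le_def]
  have hcert : (subdividedStar i).IsCertifiedDominating (M : Set (Fin (2 * i + 1))) :=
    hM ▸ isCertifiedDominating_middle_subdividedStar hi
  rw [certifiedDominationNumber_eq_card hcert fun E hE j hj => ?_]
  · simp [M]
  · obtain ⟨hj1, hji⟩ := hM.subset hj
    have hleaf : IsLeafAt (subdividedStar i) ⟨j.val + i, by omega⟩ j :=
      isLeafAt_subdividedStar hj1 rfl
    exact hleaf.support_mem hE

theorem exists_isLeafAt_addVertex_subdividedStar (hj : j.val ≤ i) :
    ∃ x, IsLeafAt ((subdividedStar i).addVertex {0}) x (some j) := by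
  by_cases hj0 : j.val = 0
  · obtain rfl : j = 0 := Fin.ext hj0
    exact ⟨none, isLeafAt_addVertex_singleton _ 0⟩
  · have hleaf : IsLeafAt (subdividedStar i) ⟨j.val + i, by omega⟩ j :=
      isLeafAt_subdividedStar (by omega) rfl
    refine ⟨_, hleaf.addVertex ?_⟩
    simp only [Set.mem_singleton_iff, Fin.ext_iff, Fin.val_zero]
    omega

theorem eq_univ_of_isCertifiedDominating_addVertex_subdividedStar
    {D : Set (Option (Fin (2 * i + 1)))}
    (hD : ((subdividedStar i).addVertex {0}).IsCertifiedDominating D) : D = Set.univ := by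
  refine Set.eq_univ_of_forall ?_
  rintro (_ | k)
  · refine (isLeafAt_addVertex_singleton _ 0).mem hD ?_
    rintro (_ | t) ht hne
    · exact absurd rfl hne
    · obtain ⟨-, ht⟩ := subdividedStar_adj.1 ht
      rw [Fin.val_zero] at ht
      exact exists_isLeafAt_addVertex_subdividedStar (by omega)
  · by_cases hki : k.val ≤ i
    · obtain ⟨x, hx⟩ := exists_isLeafAt_addVertex_subdividedStar hki
      exact hx.support_mem hD
    have hleaf : IsLeafAt (subdividedStar i) k ⟨k.val - i, by omega⟩ :=
      isLeafAt_subdividedStar (by simp only; omega) (by simp only; omega)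
    refine (hleaf.addVertex (S := {0}) fun h => hki (by simp [Set.mem_singleton_iff.1 h])).mem hD ?_
    rintro (_ | t) ht hne
    · have := congrArg Fin.val (Set.mem_singleton_iff.1 ht)
      simp only [Fin.val_zero] at this
      omega
    · obtain ⟨-, ht⟩ := subdividedStar_adj.1 ht
      have htk : t.val ≠ k.val := fun h => hne (congrArg some (Fin.ext h))
      exact exists_isLeafAt_addVertex_subdividedStar (by simp only at ht; omega)

theorem certifiedDominationNumber_addVertex_subdividedStar (i : ℕ) :
    ((subdividedStar i).addVertex {0}).certifiedDominationNumber = 2 * i + 2 := by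
  rw [certifiedDominationNumber_eq_card (D := Finset.univ)
    (by simpa using isCertifiedDominating_univ _)
    fun E hE => (eq_univ_of_isCertifiedDominating_addVertex_subdividedStar hE).ge.trans' (by simp)]
  simp

end subdividedStar

end CertifiedDomination

open CertifiedDomination in
theorem mainTheorem7_general :
    (∀ {V : Type*} (G : SimpleGraph V) (S : Set V),
      (∃ D : Finset V, G.IsCertifiedDominating (D : Set V)) →
      ((G.addVertex S).neighborSet none).encard ≠ 1 →
        (G.addVertex S).certifiedDominationNumber ≤ G.certifiedDominationNumber + 1) ∧
    (∀ i : ℕ, 1 ≤ i → ∃ (G : SimpleGraph (Fin (2 * i + 1))) (S : Set (Fin (2 * i + 1))),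
      ((G.addVertex S).neighborSet none).encard = 1 ∧
        G.certifiedDominationNumber = i ∧
        (G.addVertex S).certifiedDominationNumber = 2 * i + 2) := by
  refine ⟨fun G S hG hS => ?_, fun i hi => ⟨subdividedStar i, {0}, ?_,
    certifiedDominationNumber_subdividedStar hi,
    certifiedDominationNumber_addVertex_subdividedStar i⟩⟩
  · rw [encard_neighborSet_addVertex_none] at hS
    exact certifiedDominationNumber_addVertex_le hG hS
  · rw [encard_neighborSet_addVertex_none, Set.encard_singleton]

theorem mainTheorem7 :
    (∀ {V : Type*} [Finite V] (G : SimpleGraph V) (S : Set V),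
      ((G.addVertex S).neighborSet none).encard ≠ 1 →
        (G.addVertex S).certifiedDominationNumber ≤ G.certifiedDominationNumber + 1) ∧
    (∀ i : ℕ, 1 ≤ i → ∃ (G : SimpleGraph (Fin (2 * i + 1))) (S : Set (Fin (2 * i + 1))),
      ((G.addVertex S).neighborSet none).encard = 1 ∧
        G.certifiedDominationNumber = i ∧
        (G.addVertex S).certifiedDominationNumber = 2 * i + 2) :=
  ⟨fun G S => mainTheorem7_general.1 G S
    (G.isLeast_certifiedDominationNumber.1.imp fun _ hD => hD.1), mainTheorem7_general.{0}.2⟩
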